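/- **Conventions.** Let $\mathbf{x}=(x_i)_{i\in I}$ be a (possibly empty) family of indeterminates. An infinite matrix $[m_{n,k}]_{n,k\ge 0}$ over $\mathbb{R}$ (resp. over $\mathbb{R}[\mathbf{x}]$) is TP$_r$ (resp. $\mathbf{x}$-TP$_r$) if all its minors of order at most $r$ are nonnegative (resp. are polynomials with nonnegative coefficients), and it is TP (resp. $\mathbf{x}$-TP) if this holds for every $r$. A series $\varphi(t)=\sum_{n\ge0}\varphi_nt^n\in\mathbb{R}[[t]]$ is PF$_r$ (resp. PF) if the Toeplitz matrix $[\varphi_{i-j}]_{i,j\ge0}$, where $\varphi_n=0$ for $n<0$, is TP$_r$ (resp. TP). Let $K$ be a field of characteristic $0$. An exponential Riordan array over $K$ is a lower-triangular matrix $$R_{n,k}=\frac{n!}{k!}\,[t^n]\,g(t)f(t)^k,\qquad n,k\ge0,$$ where $g,f\in K[[t]]$, $g(0)=1$ (that is, $R_{0,0}=1$), $f(0)=0$ and $f'(0)\ne0$. If $\bar f$ is the compositional inverse of $f$, its associated series are $Z(t)=g'(\bar f(t))/g(\bar f(t))$ and $A(t)=f'(\bar f(t))$. **Theorem.** Let $[R_{n,k}]_{n,k\ge0}$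 be an exponential Riordan array with $$Z(t)=(\nu+\omega t)\varphi(t),\qquad A(t)=(a+bt+ct^2)\varphi(t).$$ (i) Let $r\ge 0$, let $\varphi\in\mathbb{R}[[t]]$ be PF$_r$, and let $a,b,c,\nu,\omega\in\mathbb{R}[\mathbf{x}]$, with $R$ an array over the field of fractions of $\mathbb{R}[\mathbf{x}]$. If the tridiagonal matrix $$J=\begin{bmatrix}\nu&a&&&\\ \omega&\nu+b&2a&&\\ &\omega+c&\nu+2b&3a&\\ &&\omega+2c&\nu+3b&\ddots\\ &&&\ddots&\ddots\end{bmatrix}$$ is $\mathbf{x}$-TP$_r$, then all $R_{n,k}$ lie in $\mathbb{R}[\mathbf{x}]$, and both the triangle $[R_{n,k}]_{n,k\ge0}$ and the Hankel matrix $[R_{i+j,0}]_{i,j\ge0}$ are $\mathbf{x}$-TP$_r$. (ii) Let $\varphi\in\mathbb{R}[[t]]$ and let $R$ be an array over $\mathbb{R}$ with $\nu,\omega,a,b,c\in\mathbb{R}^{\ge0}$, $\nu\ge\omega$ and $b\ge a+c$. If $\varphi$ is PF, then $[R_{n,k}]_{n,k\ge0}$ and $[R_{i+j,0}]_{i,j\ge0}$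 are TP. More precisely, for every $r$, if $\varphi$ is PF$_r$, then both matrices are TP$_r$. (iii) The conclusion of (ii) also holds if $\nu,\omega,a,b,c\in\mathbb{R}^{\ge0}$, $\nu\ge a$ and $b\ge\max\{a+c,\,a+\omega\}$. (iv) Let $\varphi\in\mathbb{R}[[t]]$ be PF and $\omega=c=0$. If $a,b,\nu$ are three of the indeterminates $\mathbf x$ or, more generally, polynomials in $\mathbb{R}[\mathbf{x}]$ with nonnegative coefficients, with $R$ an array over the field of fractions of $\mathbb{R}[\mathbf{x}]$, then all $R_{n,k}$ lie in $\mathbb{R}[\mathbf{x}]$, and $[R_{n,k}]_{n,k\ge0}$ and $[R_{i+j,0}]_{i,j\ge0}$ are $\mathbf{x}$-TP. In particular, they are $(a,b,\nu)$-TP when $a,b,\nu$ are indeterminates. (v) Let $F$ be any field of characteristic $0$, $m\ge0$ and $x_1,\dots,x_m,\nu,b\in F$ (for instance, real numbers, or indeterminates in a field of rational functions). Let $\varphi(t)=\prod_{i=1}^m(1+x_it)$, $\omega=c=0$ and $a=1$, with $R$ an array over $F$. Then there is the $m$-branched Stieltjes-type continued fraction $$\sum_{n\ge0}R_{n,0}t^n=\cfrac{1}{1-\alpha_mt\prod\limits_{i_1=1}^m\cfrac{1}{1-\alpha_{m+i_1}t\prod\limits_{i_2=1}^m\cfrac{1}{1-\alpha_{m+i_1+i_2}t\prod\limits_{i_3=1}^m\cfrac{1}{1-\cdots}}}}$$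 (the coefficientwise limit in $F[[t]]$ of its finite truncations), with coefficients $$(\alpha_i)_{i\ge m}=(\nu,\ x_1,\dots,x_m,\ \nu+b,\ 2x_1,\dots,2x_m,\ \nu+2b,\ 3x_1,\dots,3x_m,\ \dots).$$ -/

import Mathlib

open Filter

noncomputable section

/-! ### Total positivity -/

/-- Every minor of order `k ≤ r` of the infinite matrix `M` lies in the set `P`. -/
def MinorsIn {S : Type*} [CommRing S] (P : Set S) (r : ℕ) (M : Matrix ℕ ℕ S) : Prop :=
  ∀ k ≤ r, ∀ rows cols : Fin k → ℕ, StrictMono rows → StrictMono cols →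
    (M.submatrix rows cols).det ∈ P

/-- `TP_r` for real matrices. -/
def IsTPr (r : ℕ) (M : Matrix ℕ ℕ ℝ) : Prop :=
  MinorsIn {y : ℝ | 0 ≤ y} r M

/-- `TP` for real matrices. -/
def IsTP (M : Matrix ℕ ℕ ℝ) : Prop := ∀ r, IsTPr r M

/-- The polynomial `p` has only nonnegative coefficients. -/
def NonnegCoeffs {σ : Type*} (p : MvPolynomial σ ℝ) : Prop :=
  ∀ d : σ →₀ ℕ, 0 ≤ MvPolynomial.coeff d p

/-- Coefficientwise `TP_r` (that is, `x-TP_r`) for matrices over `ℝ[x]`,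
where `x = (x_i)_{i ∈ σ}`. -/
def IsCoeffTPr {σ : Type*} (r : ℕ) (M : Matrix ℕ ℕ (MvPolynomial σ ℝ)) : Prop :=
  MinorsIn {p : MvPolynomial σ ℝ | NonnegCoeffs p} r M

/-- Coefficientwise `TP` (that is, `x-TP`) for matrices over `ℝ[x]`. -/
def IsCoeffTP {σ : Type*} (M : Matrix ℕ ℕ (MvPolynomial σ ℝ)) : Prop :=
  ∀ r, IsCoeffTPr r M

/-- The Hankel matrix `[u_{i+j}]`. -/
def hankelMat {S : Type*} (u : ℕ → S) : Matrix ℕ ℕ S :=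
  Matrix.of fun i j => u (i + j)

/-- The lower triangular Toeplitz matrix `[φ_{i-j}]` of the coefficients of a power series. -/
def toeplitzMat (φ : PowerSeries ℝ) : Matrix ℕ ℕ ℝ :=
  Matrix.of fun i j => if j ≤ i then PowerSeries.coeff (i - j) φ else 0

/-- `PF_r` functions. -/
def IsPFr (r : ℕ) (φ : PowerSeries ℝ) : Prop := IsTPr r (toeplitzMat φ)

/-- `PF` functions. -/
def IsPF (φ : PowerSeries ℝ) : Prop := IsTP (toeplitzMat φ)

/-! ### Exponential Riordan arrays -/

/-- The matrix with entries `(n! / k!) [t^n] g(t) f(t)^k`. -/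
def expRiordan {K : Type*} [Field K] (g f : PowerSeries K) : Matrix ℕ ℕ K :=
  Matrix.of fun n k =>
    ((n.factorial : K) / (k.factorial : K)) * PowerSeries.coeff n (g * f ^ k)

/-- `R` is the exponential Riordan array `(g, f)` of some `g`, `f` with `g(0) = 1`, `f(0) = 0`,
`f'(0) ≠ 0`, whose associated series are `Z = g'(fbar) / g(fbar)` and `A = f'(fbar)`,
where `fbar` is the compositional inverse of `f`. -/
def IsExpRiordanArray {K : Type*} [Field K] (R : Matrix ℕ ℕ K) (Z A : PowerSeries K) : Prop :=
  ∃ g f fbar : PowerSeries K,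
    PowerSeries.constantCoeff g = 1 ∧
    PowerSeries.constantCoeff f = 0 ∧
    PowerSeries.coeff 1 f ≠ 0 ∧
    PowerSeries.constantCoeff fbar = 0 ∧
    PowerSeries.subst fbar f = (PowerSeries.X : PowerSeries K) ∧
    PowerSeries.subst f fbar = (PowerSeries.X : PowerSeries K) ∧
    Z = (PowerSeries.subst fbar (PowerSeries.derivative K g) : PowerSeries K) *
      (PowerSeries.subst fbar g : PowerSeries K)⁻¹ ∧
    A = PowerSeries.subst fbar (PowerSeries.derivative K f) ∧
    R = expRiordan g f

/-- `Z(t) = (ν + ω t) φ(t)`. -/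
def zSeries {S : Type*} [CommRing S] (ν ω : S) (φ : PowerSeries S) : PowerSeries S :=
  (PowerSeries.C ν + PowerSeries.C ω * PowerSeries.X) * φ

/-- `A(t) = (a + b t + c t^2) φ(t)`. -/
def aSeries {S : Type*} [CommRing S] (a b c : S) (φ : PowerSeries S) : PowerSeries S :=
  (PowerSeries.C a + PowerSeries.C b * PowerSeries.X + PowerSeries.C c * PowerSeries.X ^ 2) * φ

/-- The tridiagonal matrix with diagonal entries `ν + n b`, superdiagonal entries `(n + 1) a`
and subdiagonal entries `ω + n c`, for `n = 0, 1, 2, …`. -/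
def tridiagJ {S : Type*} [CommRing S] (ν ω a b c : S) : Matrix ℕ ℕ S :=
  Matrix.of fun i j =>
    if j = i + 1 then ((i : S) + 1) * a
    else if j = i then ν + (i : S) * b
    else if i = j + 1 then ω + (j : S) * c
    else 0

/-! ### Branched continued fractions -/

/-- Truncation after `d` levels of the `m`-branched Stieltjes-type continued fraction with
coefficients `(α_i)_{i ≥ m}`, started at position `k`:
`T_0(k) = 1` and `T_{d+1}(k) = 1 / (1 - α_{m+k} t ∏_{i=1}^m T_d(k+i))`. The whole fraction
is started at `k = 0`. -/
def branchedSTrunc {K : Type*} [Field K] (m : ℕ) (α : ℕ → K) : ℕ → ℕ → PowerSeries K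
  | 0, _ => 1
  | d + 1, k =>
      (1 - PowerSeries.C (α (m + k)) * PowerSeries.X *
        ∏ i : Fin m, branchedSTrunc m α d (k + ((i : ℕ) + 1)))⁻¹

/-- The formal power series `F` is the value of the `m`-branched Stieltjes-type continued fraction
with coefficients `(α_i)_{i ≥ m}`: each coefficient of `F` is the eventually constant value of
the corresponding coefficient of the truncations. -/
def IsBranchedSFraction {K : Type*} [Field K] (m : ℕ) (α : ℕ → K) (F : PowerSeries K) : Prop :=
  ∀ n, ∀ᶠ d in atTop, PowerSeries.coeff n (branchedSTrunc m α d 0) = PowerSeries.coeff n F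

end

/-! ### The Cauchy–Binet formula and products of totally positive matrices -/

/-! The associated series encode the differential equations `g' = g Z(f)` and `f' = A(f)`, so `(g
f^k)' = g · (X^k Z + k X^(k-1) A)(f)`. Comparing coefficients, the numbers `n! [t^n] g f^k` form the
output matrix of the production matrix `Q` with entries `[X^i] (X^k Z + k X^(k-1) A)`. For the given
`Z` and `A`, `Q` is the Toeplitz matrix of `φ` times `J`, and `R` is the output matrix with column
`k` divided by `k!`.

Total positivity then follows from Cauchy–Binet (`MinorsIn.mul_of_finite_sums`): `Q` inherits it
from its two factors, the output matrix inherits it from `Q` row by row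
(`minorsIn_of_row_recurrence`), and the Hankel matrix factors as output matrix times input matrix,
because `(Q^(i+j))_00 = Σ_k (Q^i)_0k (Q^j)_k0`. Working with a subsemiring `P` of allowed minors
covers real and coefficientwise positivity at once. It remains to treat `J`: diagonal dominance by
columns or by rows gives a nonnegative LU factorization, and `ω = c = 0` makes `J` upper bidiagonal.

For the continued fraction, let `f_k` be its tail started at `k` and `G_k = f_0 ⋯ f_(k-1)`. Clearing
denominators gives `G_(k+1) = G_k + α_(m+k) t G_(k+m+1)`. The linear map `X^k ↦ k! t^k G_(k(m+1)+1)`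
turns multiplication by a factor `1 + x_i X` of `φ` into an index shift by one, and so satisfies the
same recursion as the functionals `p ↦ n! [t^n] g p(f)`. The two agree, and `p = 1` gives `f_0 = Σ
R_(n,0) t^n`. -/

/-- A determinant of a product of rectangular matrices, expanded along the rows of the product. -/
lemma Matrix.det_mul_eq_sum_prod_mul_det {S : Type*} [CommRing S] {k N : ℕ}
    (A : Matrix (Fin k) (Fin N) S) (B : Matrix (Fin N) (Fin k) S) :
    (A * B).det = ∑ p : Fin k → Fin N, (∏ i, A i (p i)) * (B.submatrix p id).det := by
  have hrow : A * B = fun i => ∑ j, A i j • B j := by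
    ext i l
    simp [Matrix.mul_apply, Finset.sum_apply]
  have h := (Matrix.detRowAlternating (n := Fin k) (R := S)).toMultilinearMap.map_sum
    (fun i j => A i j • B j)
  have h2 : (A * B).det = ∑ p : Fin k → Fin N,
      (Matrix.detRowAlternating (n := Fin k) (R := S)).toMultilinearMap
        (fun i => A i (p i) • B (p i)) := by
    rw [← h, hrow]
    rfl
  rw [h2]
  refine Finset.sum_congr rfl fun p _ => ?_
  rw [MultilinearMap.map_smul_univ]
  rfl

/-- The Cauchy–Binet formula. -/
theorem Matrix.det_mul_eq_sum_strictMono {S : Type*} [CommRing S] {k N : ℕ}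
    (A : Matrix (Fin k) (Fin N) S) (B : Matrix (Fin N) (Fin k) S) :
    (A * B).det = ∑ s : {s : Fin k → Fin N // StrictMono s},
      (A.submatrix id s.1).det * (B.submatrix s.1 id).det := by
  classical
  rw [Matrix.det_mul_eq_sum_prod_mul_det]
  have hinj : ∑ p : Fin k → Fin N, (∏ i, A i (p i)) * (B.submatrix p id).det =
      ∑ p : Fin k → Fin N with Function.Injective p,
        (∏ i, A i (p i)) * (B.submatrix p id).det := by
    refine (Finset.sum_filter_of_ne fun p _ hp => ?_).symm
    by_contra hni
    obtain ⟨i, j, hij, hne⟩ := Function.not_injective_iff.mp hni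
    refine hp ?_
    rw [Matrix.det_zero_of_row_eq hne (by ext l; simp [hij]), mul_zero]
  rw [hinj]
  have hR : ∀ s : {s : Fin k → Fin N // StrictMono s},
      (A.submatrix id s.1).det * (B.submatrix s.1 id).det =
        ∑ τ : Equiv.Perm (Fin k), (∏ i, A i (s.1 (τ i))) * (B.submatrix (s.1 ∘ τ) id).det := by
    intro s
    rw [← Matrix.det_transpose, Matrix.det_apply', Finset.sum_mul]
    refine Finset.sum_congr rfl fun τ _ => ?_
    have : B.submatrix (s.1 ∘ τ) id = (B.submatrix s.1 id).submatrix τ id := rfl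
    rw [this, Matrix.det_permute]
    simp only [Matrix.transpose_apply, Matrix.submatrix_apply, id]
    ring
  rw [Finset.sum_congr rfl fun s _ => hR s, ← Fintype.sum_prod_type']
  symm
  -- An injective `p` is uniquely an increasing map composed with a permutation; sorting `p`
  -- produces both.
  refine Finset.sum_bij (fun x _ => x.1.1 ∘ x.2) ?_ ?_ ?_ ?_
  · rintro ⟨s, τ⟩ _
    simpa using s.2.injective.comp τ.injective
  · rintro ⟨⟨s, hs⟩, τ⟩ _ ⟨⟨s', hs'⟩, τ'⟩ _ h
    have hss : s = s' := by
      refine (hs.range_inj hs').mp ?_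
      have := congrArg Set.range h
      simpa [Set.range_comp] using this
    subst hss
    have : τ = τ' := Equiv.ext fun i => hs.injective (congrFun h i)
    rw [this]
  · intro p hp
    have hp' : Function.Injective p := by simpa using hp
    refine ⟨⟨⟨p ∘ Tuple.sort p, (Tuple.monotone_sort p).strictMono_of_injective
      (hp'.comp (Tuple.sort p).injective)⟩, (Tuple.sort p)⁻¹⟩, Finset.mem_univ _, ?_⟩
    ext i
    simp
  · intro x _
    rfl

/-- If all minors of order at most `r` of `A` and `B` lie in the subsemiring `P`, so do those of
their product `C`, where every entry of `C` is a finite sum. -/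
theorem MinorsIn.mul_of_finite_sums {S : Type*} [CommRing S] {P : Subsemiring S} {r : ℕ}
    {A B C : Matrix ℕ ℕ S} (hA : MinorsIn (P : Set S) r A) (hB : MinorsIn (P : Set S) r B)
    (bound : ℕ → ℕ → ℕ)
    (hC : ∀ i j, ∀ N ≥ bound i j, C i j = ∑ l ∈ Finset.range N, A i l * B l j) :
    MinorsIn (P : Set S) r C := by
  intro k hk rows cols hrows hcols
  -- One cutoff large enough for all the selected entries, so that the submatrix is a product of
  -- finite matrices.
  set N := ∑ i, ∑ j, bound (rows i) (cols j)
  have hN : ∀ i j, bound (rows i) (cols j) ≤ N := fun i j =>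
    (Finset.single_le_sum (f := fun j => bound (rows i) (cols j)) (fun _ _ => Nat.zero_le _)
      (Finset.mem_univ j)).trans
    (Finset.single_le_sum (f := fun i => ∑ j, bound (rows i) (cols j)) (fun _ _ => Nat.zero_le _)
      (Finset.mem_univ i))
  have hprod : C.submatrix rows cols =
      A.submatrix rows (Fin.val : Fin N → ℕ) * B.submatrix (Fin.val : Fin N → ℕ) cols := by
    ext i j
    rw [Matrix.submatrix_apply, hC _ _ N (hN i j), Matrix.mul_apply,
      ← Fin.sum_univ_eq_sum_range (fun l => A (rows i) l * B l (cols j))]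
    rfl
  rw [hprod, Matrix.det_mul_eq_sum_strictMono]
  refine sum_mem fun s _ => mul_mem ?_ ?_
  · exact hA k hk rows _ hrows (Fin.val_strictMono.comp s.2)
  · exact hB k hk _ cols (Fin.val_strictMono.comp s.2) hcols

theorem MinorsIn.transpose {S : Type*} [CommRing S] {P : Set S} {r : ℕ} {A : Matrix ℕ ℕ S}
    (hA : MinorsIn P r A) : MinorsIn P r A.transpose := by
  intro k hk rows cols hrows hcols
  rw [← Matrix.det_transpose]
  exact hA k hk cols rows hcols hrows

/-- Scaling the columns by elements of `P` preserves `MinorsIn`. -/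
theorem MinorsIn.scale_columns {S : Type*} [CommRing S] {P : Subsemiring S} {r : ℕ}
    {A : Matrix ℕ ℕ S} (hA : MinorsIn (P : Set S) r A) (v : ℕ → S) (hv : ∀ j, v j ∈ P) :
    MinorsIn (P : Set S) r (Matrix.of fun i j => v j * A i j) := by
  intro k hk rows cols hrows hcols
  have := Matrix.det_mul_row (fun j => v (cols j)) (A.submatrix rows cols)
  have h2 : (Matrix.of fun i j => v j * A i j).submatrix rows cols =
      Matrix.of fun i j => v (cols j) * (A.submatrix rows cols) i j := rfl
  rw [h2, this]
  exact mul_mem (prod_mem fun j _ => hv _) (hA k hk rows cols hrows hcols)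

theorem MinorsIn.map {S T : Type*} [CommRing S] [CommRing T] {P : Set S} {Q : Set T} {r : ℕ}
    {A : Matrix ℕ ℕ S} (hA : MinorsIn P r A) (h : S →+* T) (hPQ : ∀ x ∈ P, h x ∈ Q) :
    MinorsIn Q r (A.map h) := by
  intro k hk rows cols hrows hcols
  have : (A.map h).submatrix rows cols = h.mapMatrix (A.submatrix rows cols) := rfl
  rw [this, ← RingHom.map_det]
  exact hPQ _ (hA k hk rows cols hrows hcols)

/-! ### Bidiagonal and tridiagonal matrices -/

/-- The upper bidiagonal matrix with diagonal `d` and superdiagonal `u`. -/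
def upperBidiag {S : Type*} [CommRing S] (d u : ℕ → S) : Matrix ℕ ℕ S :=
  Matrix.of fun i j => if j = i + 1 then u i else if j = i then d i else 0

/-- An upper bidiagonal matrix with entries in `P` has all its minors in `P`. -/
theorem minorsIn_upperBidiag {S : Type*} [CommRing S] {P : Subsemiring S} {d u : ℕ → S}
    (hd : ∀ i, d i ∈ P) (hu : ∀ i, u i ∈ P) (r : ℕ) :
    MinorsIn (P : Set S) r (upperBidiag d u) := by
  have hent : ∀ i j, upperBidiag d u i j ∈ P := by
    intro i j
    simp only [upperBidiag, Matrix.of_apply]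
    split_ifs
    exacts [hu i, hd i, zero_mem P]
  intro k _
  induction k with
  | zero => intro rows cols _ _; simp [one_mem]
  | succ k ih =>
    intro rows cols hrows hcols
    -- If `rows 0 < cols 0`, the later columns lie beyond the superdiagonal of the first row;
    -- otherwise the later rows lie below the diagonal of the first column. Either way only the
    -- corner entry survives in the expansion.
    have hmin : ((upperBidiag d u).submatrix rows cols).det =
        upperBidiag d u (rows 0) (cols 0) *
          ((upperBidiag d u).submatrix (rows ∘ Fin.succ) (cols ∘ Fin.succ)).det := by
      by_cases h : rows 0 < cols 0
      · rw [Matrix.det_succ_row_zero, Fin.sum_univ_succ, Finset.sum_eq_zero]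
        · simp [Matrix.submatrix_submatrix, Function.comp_def]
        · intro j _
          have h1 : cols 0 < cols j.succ := hcols (Fin.succ_pos j)
          have h2 : upperBidiag d u (rows 0) (cols j.succ) = 0 := by
            simp only [upperBidiag, Matrix.of_apply]
            rw [if_neg (by omega), if_neg (by omega)]
          simp [h2]
      · rw [Matrix.det_succ_column_zero, Fin.sum_univ_succ, Finset.sum_eq_zero]
        · simp [Matrix.submatrix_submatrix, Function.comp_def]
        · intro j _
          have h1 : rows 0 < rows j.succ := hrows (Fin.succ_pos j)
          have h2 : upperBidiag d u (rows j.succ) (cols 0) = 0 := by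
            simp only [upperBidiag, Matrix.of_apply]
            rw [if_neg (by omega), if_neg (by omega)]
          simp [h2]
    rw [hmin]
    exact mul_mem (hent _ _) (ih (by omega) _ _ (hrows.comp Fin.strictMono_succ)
      (hcols.comp Fin.strictMono_succ))

/-- The tridiagonal matrix with diagonal `d`, superdiagonal `u` and subdiagonal `l`. -/
def tridiag {S : Type*} [CommRing S] (d u l : ℕ → S) : Matrix ℕ ℕ S :=
  Matrix.of fun i j =>
    if j = i + 1 then u i else if j = i then d i else if i = j + 1 then l j else 0

theorem tridiag_transpose {S : Type*} [CommRing S] (d u l : ℕ → S) :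
    (tridiag d u l).transpose = tridiag d l u := by
  ext i j
  simp only [tridiag, Matrix.transpose_apply, Matrix.of_apply]
  split_ifs <;> first | rfl | omega | (subst_vars; rfl)

/-- A nonnegative tridiagonal matrix which is diagonally dominant by columns is totally positive. -/
theorem minorsIn_tridiag_of_columnDominant {d u l : ℕ → ℝ} (hu : ∀ n, 0 ≤ u n) (hl : ∀ n, 0 ≤ l n)
    (h0 : l 0 ≤ d 0) (hdom : ∀ n, u n + l (n + 1) ≤ d (n + 1)) (r : ℕ) :
    MinorsIn (Subsemiring.nonneg ℝ : Set ℝ) r (tridiag d u l) := by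
  -- The pivots of Gaussian elimination, that is, the diagonal of the factor U.
  let s : ℕ → ℝ := fun n => Nat.rec (d 0) (fun n sn => d (n + 1) - l n / sn * u n) n
  have hs : ∀ n, s (n + 1) = d (n + 1) - l n / s n * u n := fun n => rfl
  -- The invariant keeping all pivots nonnegative: the multiplier `l n / s n` is at most `1`, so
  -- dominance passes to the next column.
  have hls : ∀ n, l n ≤ s n := by
    intro n
    induction n with
    | zero => exact h0
    | succ n ih =>
      rw [hs]
      have h1 : l n / s n ≤ 1 := div_le_one_of_le₀ ih ((hl n).trans ih)
      have h2 := mul_le_mul_of_nonneg_right h1 (hu n)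
      linarith [hdom n]
  have hs0 : ∀ n, 0 ≤ s n := fun n => (hl n).trans (hls n)
  -- A zero pivot forces `l n = 0`, so the convention `0 / 0 = 0` still gives a valid factorization.
  have hq : ∀ n, l n / s n * s n = l n := by
    intro n
    rcases eq_or_ne (s n) 0 with h | h
    · have : l n = 0 := le_antisymm (h ▸ hls n) (hl n)
      simp [this]
    · exact div_mul_cancel₀ _ h
  have hL : MinorsIn (Subsemiring.nonneg ℝ : Set ℝ) r
      (upperBidiag (fun _ => 1) (fun n => l n / s n)).transpose :=
    (minorsIn_upperBidiag (fun _ => by simp) (fun n => div_nonneg (hl n) (hs0 n)) r).transpose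
  have hU : MinorsIn (Subsemiring.nonneg ℝ : Set ℝ) r (upperBidiag s u) :=
    minorsIn_upperBidiag hs0 hu r
  refine hL.mul_of_finite_sums hU (fun i _ => i + 1) fun i j N hN => ?_
  cases i with
  | zero =>
    rw [Finset.sum_eq_single_of_mem 0 (Finset.mem_range.mpr hN)]
    · simp only [upperBidiag, tridiag, Matrix.transpose_apply, Matrix.of_apply]
      rcases j with _ | _ | j
      · simp [s]
      · simp
      · simp
    · intro b _ hb
      simp only [upperBidiag, Matrix.transpose_apply, Matrix.of_apply]
      rw [if_neg (by omega), if_neg (by omega), zero_mul]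
  | succ i =>
    have hsub : ({i, i + 1} : Finset ℕ) ⊆ Finset.range N := by
      intro x hx
      simp only [Finset.mem_insert, Finset.mem_singleton] at hx
      rw [Finset.mem_range]
      omega
    rw [← Finset.sum_subset hsub, Finset.sum_pair (by omega)]
    · simp only [upperBidiag, tridiag, Matrix.transpose_apply, Matrix.of_apply]
      rcases lt_trichotomy j (i + 1) with h | h | h
      · rcases eq_or_ne j i with h' | h'
        · subst h'
          simp (disch := omega) [hq, if_neg]
        · simp (disch := omega) [if_neg]
      · subst h
        simp [hs]
      · simp (disch := omega) [if_neg]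
    · intro b _ hb
      simp only [Finset.mem_insert, Finset.mem_singleton] at hb
      simp only [upperBidiag, Matrix.transpose_apply, Matrix.of_apply]
      rw [if_neg (by omega), if_neg (by omega), zero_mul]

/-! ### Total positivity of output matrices -/

/-- Putting the row `e₀` on top of a matrix preserves `MinorsIn`. -/
theorem MinorsIn.cons_row {S : Type*} [CommRing S] {P : Subsemiring S} {r : ℕ}
    {B C : Matrix ℕ ℕ S} (hB : MinorsIn (P : Set S) r B) (h0 : C 0 0 = 1)
    (h0' : ∀ j, 0 < j → C 0 j = 0) (hC : ∀ i j, C (i + 1) j = B i j) :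
    MinorsIn (P : Set S) r C := by
  have hpos : ∀ k ≤ r, ∀ rows cols : Fin k → ℕ, StrictMono rows → StrictMono cols →
      (∀ i, 0 < rows i) → (C.submatrix rows cols).det ∈ P := by
    intro k hk rows cols hrows hcols hp
    have : C.submatrix rows cols = B.submatrix (fun i => rows i - 1) cols := by
      ext i j
      rw [Matrix.submatrix_apply, Matrix.submatrix_apply, ← hC, Nat.sub_add_cancel (hp i)]
    rw [this]
    refine hB k hk _ cols (fun i j hij => ?_) hcols
    have := hrows hij
    have := hp i
    show rows i - 1 < rows j - 1
    omega
  intro k hk rows cols hrows hcols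
  cases k with
  | zero => exact hpos 0 hk rows cols hrows hcols (fun i => i.elim0)
  | succ k =>
    by_cases hr : rows 0 = 0
    · have hrow : ∀ j : Fin k, C (rows 0) (cols j.succ) = 0 := fun j => by
        rw [hr]
        exact h0' _ ((Nat.zero_le _).trans_lt (hcols (Fin.succ_pos j)))
      have hdet : (C.submatrix rows cols).det =
          C (rows 0) (cols 0) * (C.submatrix (rows ∘ Fin.succ) (cols ∘ Fin.succ)).det := by
        rw [Matrix.det_succ_row_zero, Fin.sum_univ_succ, Finset.sum_eq_zero]
        · simp [Matrix.submatrix_submatrix, Function.comp_def]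
        · intro j _
          simp [hrow]
      rw [hdet]
      refine mul_mem ?_ (hpos k (by omega) _ _ (hrows.comp Fin.strictMono_succ)
        (hcols.comp Fin.strictMono_succ) fun i =>
          (Nat.zero_le _).trans_lt (hrows (Fin.succ_pos i)))
      rw [hr]
      rcases Nat.eq_zero_or_pos (cols 0) with h | h
      · rw [h, h0]
        exact one_mem P
      · rw [h0' _ h]
        exact zero_mem P
    · refine hpos _ hk rows cols hrows hcols fun i => ?_
      exact (Nat.pos_of_ne_zero hr).trans_le (hrows.monotone (Fin.zero_le i))

/-- A matrix with row `0` equal to `e₀`, and row `n + 1` equal to row `n` times `Q`, inherits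
total positivity from `Q`. -/
theorem minorsIn_of_row_recurrence {S : Type*} [CommRing S] {P : Subsemiring S} {r : ℕ}
    {C Q : Matrix ℕ ℕ S} (hQ : MinorsIn (P : Set S) r Q) (h0 : C 0 0 = 1)
    (h0' : ∀ j, 0 < j → C 0 j = 0) (bound : ℕ → ℕ → ℕ)
    (hC : ∀ n k, ∀ N ≥ bound n k, C (n + 1) k = ∑ l ∈ Finset.range N, C n l * Q l k) :
    MinorsIn (P : Set S) r C := by
  -- Keep only the first `m` rows: the first `m + 1` rows are `e₀` on top of the first `m` rows
  -- times `Q`, so each induction step is one product and one `cons_row`.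
  have key : ∀ m : ℕ, MinorsIn (P : Set S) r
      (Matrix.of fun i j => if i < m then C i j else 0) := by
    intro m
    induction m with
    | zero =>
      intro k _ rows cols _ _
      have : (Matrix.of fun i j => if i < 0 then C i j else 0).submatrix rows cols = 0 := by
        ext i j
        simp
      rw [this]
      rcases k with _ | k
      · simp [one_mem]
      · rw [Matrix.det_zero]
        exact zero_mem P
    | succ m ih =>
      have hprod : MinorsIn (P : Set S) r
          (Matrix.of fun i j => if i < m then C (i + 1) j else 0) := by
        refine ih.mul_of_finite_sums hQ bound fun i j N hN => ?_
        by_cases h : i < m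
        · simp [h, hC i j N hN]
        · simp [h]
      refine hprod.cons_row ?_ ?_ ?_
      · simp [h0]
      · intro j hj
        simp [h0' j hj]
      · intro i j
        simp
  intro k hk rows cols hrows hcols
  have h := key (∑ i, (rows i + 1)) k hk rows cols hrows hcols
  have hlt : ∀ i, rows i < ∑ i, (rows i + 1) := fun i =>
    (Nat.lt_succ_self _).trans_le
      (Finset.single_le_sum (f := fun i => rows i + 1) (fun _ _ => Nat.zero_le _)
        (Finset.mem_univ i))
  have heq : C.submatrix rows cols =
      (Matrix.of fun i j => if i < ∑ i, (rows i + 1) then C i j else 0).submatrix rows cols := by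
    ext i j
    simp only [Matrix.submatrix_apply, Matrix.of_apply]
    rw [if_pos (hlt i)]
  rw [heq]
  exact h

/-- The matrix generated by a production matrix `Q`: row `0` is `e₀`, and row `n + 1` is row `n`
times `Q`. For lower Hessenberg `Q`, row `n` is supported in `[0, n]`. -/
def outputMat {S : Type*} [CommRing S] (Q : Matrix ℕ ℕ S) : ℕ → ℕ → S
  | 0, k => if k = 0 then 1 else 0
  | n + 1, k => ∑ i ∈ Finset.range (n + 1), outputMat Q n i * Q i k

/-- The matrix whose column `n` is the zeroth column of `Q ^ n`, for lower Hessenberg `Q`. -/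
def inputMat {S : Type*} [CommRing S] (Q : Matrix ℕ ℕ S) : ℕ → ℕ → S
  | k, 0 => if k = 0 then 1 else 0
  | k, n + 1 => ∑ i ∈ Finset.range (k + 2), Q k i * inputMat Q i n

section Output

variable {S : Type*} [CommRing S] {Q : Matrix ℕ ℕ S}

lemma outputMat_eq_zero_of_lt (hess : ∀ i j, i + 1 < j → Q i j = 0) :
    ∀ n k, n < k → outputMat Q n k = 0
  | 0, k, h => by rw [outputMat, if_neg (by omega)]
  | n + 1, k, h => by
    rw [outputMat]
    refine Finset.sum_eq_zero fun i hi => ?_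
    rw [hess i k (by have := Finset.mem_range.mp hi; omega), mul_zero]

theorem minorsIn_outputMat {P : Subsemiring S} {r : ℕ} (hQ : MinorsIn (P : Set S) r Q)
    (hess : ∀ i j, i + 1 < j → Q i j = 0) :
    MinorsIn (P : Set S) r (Matrix.of (outputMat Q)) := by
  refine minorsIn_of_row_recurrence hQ ?_ ?_ (fun n _ => n + 1) ?_
  · simp [outputMat]
  · intro j hj
    simp [outputMat, hj.ne']
  · intro n k N hN
    simp only [Matrix.of_apply]
    rw [outputMat]
    refine Finset.sum_subset (Finset.range_mono hN) fun i _ hi => ?_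
    rw [outputMat_eq_zero_of_lt hess n i (by simpa using hi), zero_mul]

/-- The transpose satisfies a row recurrence with matrix `Q.transpose`. -/
theorem minorsIn_inputMat {P : Subsemiring S} {r : ℕ} (hQ : MinorsIn (P : Set S) r Q)
    (hess : ∀ i j, i + 1 < j → Q i j = 0) :
    MinorsIn (P : Set S) r (Matrix.of (inputMat Q)) := by
  have h : MinorsIn (P : Set S) r (Matrix.of (inputMat Q)).transpose := by
    refine minorsIn_of_row_recurrence hQ.transpose ?_ ?_ (fun _ k => k + 2) ?_
    · simp [inputMat]
    · intro j hj
      simp [inputMat, hj.ne']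
    · intro n k N hN
      simp only [Matrix.transpose_apply, Matrix.of_apply]
      rw [inputMat, Finset.sum_congr rfl fun i _ => mul_comm _ _]
      refine Finset.sum_subset (Finset.range_mono hN) fun i _ hi => ?_
      rw [hess k i (by have := Finset.mem_range.not.mp hi; omega), mul_zero]
  exact h.transpose

/-- This is `(Q^(i+j))_00 = Σ_k (Q^i)_0k (Q^j)_k0`; the induction moves one factor `Q` at a time
from the left power to the right one. -/
lemma outputMat_add_eq_sum (hess : ∀ i j, i + 1 < j → Q i j = 0) (j : ℕ) :
    ∀ i, outputMat Q (i + j) 0 = ∑ k ∈ Finset.range (i + 1), outputMat Q i k * inputMat Q k j := by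
  induction j with
  | zero =>
    intro i
    rw [Finset.sum_eq_single_of_mem 0 (by simp)]
    · simp [inputMat]
    · intro k _ hk
      simp [inputMat, hk]
  | succ j ih =>
    intro i
    rw [show i + (j + 1) = i + 1 + j by ring, ih (i + 1)]
    have h1 : ∀ k, outputMat Q (i + 1) k * inputMat Q k j =
        ∑ l ∈ Finset.range (i + 1), outputMat Q i l * (Q l k * inputMat Q k j) := fun k => by
      rw [outputMat, Finset.sum_mul]
      exact Finset.sum_congr rfl fun l _ => mul_assoc _ _ _
    rw [Finset.sum_congr rfl fun k _ => h1 k, Finset.sum_comm]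
    refine Finset.sum_congr rfl fun l hl => ?_
    rw [← Finset.mul_sum, inputMat]
    congr 1
    have hl' := Finset.mem_range.mp hl
    refine (Finset.sum_subset (Finset.range_mono (by omega)) fun k _ hk => ?_).symm
    rw [hess l k (by have := Finset.mem_range.not.mp hk; omega), zero_mul]

/-- The Hankel matrix of the zeroth column of the output matrix inherits total positivity from the
production matrix. -/
theorem minorsIn_hankelMat_outputMat {P : Subsemiring S} {r : ℕ} (hQ : MinorsIn (P : Set S) r Q)
    (hess : ∀ i j, i + 1 < j → Q i j = 0) :
    MinorsIn (P : Set S) r (hankelMat fun n => outputMat Q n 0) := by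
  refine (minorsIn_outputMat hQ hess).mul_of_finite_sums (minorsIn_inputMat hQ hess)
    (fun i _ => i + 1) fun i j N hN => ?_
  simp only [hankelMat, Matrix.of_apply]
  rw [outputMat_add_eq_sum hess]
  refine Finset.sum_subset (Finset.range_mono hN) fun k _ hk => ?_
  rw [outputMat_eq_zero_of_lt hess i k (by simpa using hk), zero_mul]

end Output

/-! ### Production matrices of exponential Riordan arrays -/

section Riordan

open PowerSeries

/-- The Riordan array is governed by the differential equations `g' = g Z(f)` and `f' = A(f)`. -/
theorem IsExpRiordanArray.exists_derivative_eq {K : Type*} [Field K] {R : Matrix ℕ ℕ K}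
    {Z A : PowerSeries K} (h : IsExpRiordanArray R Z A) :
    ∃ g f : PowerSeries K, constantCoeff g = 1 ∧ constantCoeff f = 0 ∧
      derivative K g = g * (subst f Z : PowerSeries K) ∧
      derivative K f = (subst f A : PowerSeries K) ∧ R = expRiordan g f := by
  obtain ⟨g, f, fb, hg, hf, -, hfb, -, hffb, hZ, hA, hR⟩ := h
  have hsf : HasSubst f := HasSubst.of_constantCoeff_zero' hf
  have hsfb : HasSubst fb := HasSubst.of_constantCoeff_zero' hfb
  have hcancel : ∀ p : PowerSeries K, (subst f (subst fb p : PowerSeries K) : PowerSeries K) = p := by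
    intro p
    rw [subst_comp_subst_apply hsfb hsf, hffb, X_subst]
  refine ⟨g, f, hg, hf, ?_, ?_, hR⟩
  · have hunit : constantCoeff (subst fb g : PowerSeries K) ≠ 0 := by
      intro h0
      have h1 : constantCoeff (subst f (subst fb g : PowerSeries K) : PowerSeries K) = 0 :=
        constantCoeff_subst_eq_zero hf _ h0
      rw [hcancel, hg] at h1
      exact one_ne_zero h1
    have h2 : Z * (subst fb g : PowerSeries K) = (subst fb (derivative K g) : PowerSeries K) := by
      rw [hZ, mul_assoc, PowerSeries.inv_mul_cancel _ hunit, mul_one]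
    have h3 := congrArg (fun p : PowerSeries K => (subst f p : PowerSeries K)) h2
    simp only [subst_mul hsf, hcancel] at h3
    rw [← h3, mul_comm]
  · rw [hA, hcancel]

/-- Since `f` has no constant term, `f ^ i` with `i > n` does not reach degree `n`, and `p` may be
truncated. -/
lemma PowerSeries.coeff_mul_subst {K : Type*} [Field K] {f : PowerSeries K}
    (hf : constantCoeff f = 0) (g p : PowerSeries K) (n : ℕ) :
    coeff n (g * (subst f p : PowerSeries K)) =
      ∑ i ∈ Finset.range (n + 1), coeff i p * coeff n (g * f ^ i) := by
  have hsf : HasSubst f := HasSubst.of_constantCoeff_zero' hf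
  conv_lhs => rw [eq_X_pow_mul_shift_add_trunc (n + 1) p]
  rw [subst_add hsf, subst_mul hsf, subst_pow hsf, subst_X hsf, subst_coe hsf, mul_add, map_add]
  have hz : coeff n (g * (f ^ (n + 1) *
      (subst f (mk fun i => coeff (i + (n + 1)) p) : PowerSeries K))) = 0 := by
    obtain ⟨f', rfl⟩ := X_dvd_iff.mpr hf
    rw [show ∀ s : PowerSeries K, g * ((X * f') ^ (n + 1) * s) = X ^ (n + 1) * (g * f' ^ (n + 1) * s)
      from fun s => by ring, coeff_X_pow_mul', if_neg (by omega)]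
  rw [hz, zero_add, trunc_apply, map_sum, Finset.mul_sum, map_sum, Nat.Ico_zero_eq_range]
  refine Finset.sum_congr rfl fun i _ => ?_
  rw [Polynomial.aeval_monomial, mul_left_comm, ← Algebra.smul_def, map_smul, smul_eq_mul]

/-- The recurrence between consecutive rows of an exponential Riordan array. -/
theorem coeff_succ_riordan {K : Type*} [Field K] {g f Z A : PowerSeries K}
    (hf : constantCoeff f = 0) (hg' : derivative K g = g * (subst f Z : PowerSeries K))
    (hf' : derivative K f = (subst f A : PowerSeries K)) (n k : ℕ) :
    coeff (n + 1) (g * f ^ k) * (n + 1) =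
      ∑ i ∈ Finset.range (n + 1),
        coeff i (X ^ k * Z + (k : PowerSeries K) * X ^ (k - 1) * A) * coeff n (g * f ^ i) := by
  have hsf : HasSubst f := HasSubst.of_constantCoeff_zero' hf
  -- Both sides are now coefficients of `(g f^k)'`, expanded by the product and chain rules.
  rw [← coeff_derivative, ← coeff_mul_subst hf]
  congr 1
  have hk : (subst f (k : PowerSeries K) : PowerSeries K) = (k : PowerSeries K) := by
    rw [← coe_substAlgHom hsf, map_natCast]
  rw [Derivation.leibniz, derivative_pow, hg', hf', subst_add hsf, subst_mul hsf, subst_mul hsf,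
    subst_mul hsf, subst_pow hsf, subst_pow hsf, subst_X hsf, hk]
  simp only [smul_eq_mul]
  ring

/-- The production matrix, up to diagonal conjugation: the product of the Toeplitz matrix of `φ`
with the tridiagonal matrix. -/
noncomputable def toeplitzTridiag {S : Type*} [CommRing S] (φ : PowerSeries S) (ν ω a b c : S) :
    Matrix ℕ ℕ S :=
  Matrix.of fun i k => ∑ l ∈ Finset.range (i + 1), coeff (i - l) φ * tridiagJ ν ω a b c l k

/-- Column `k` of the tridiagonal matrix has generating function `X^k (ν + ω X) + k X^(k-1) (a + b X
+ c X^2)`, and the Toeplitz matrix acts as multiplication by `φ`. -/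
lemma toeplitzTridiag_eq_coeff {S : Type*} [CommRing S] (φ : PowerSeries S) (ν ω a b c : S)
    (i k : ℕ) :
    toeplitzTridiag φ ν ω a b c i k =
      coeff i (X ^ k * zSeries ν ω φ + (k : PowerSeries S) * X ^ (k - 1) * aSeries a b c φ) := by
  have hcol : X ^ k * zSeries ν ω φ + (k : PowerSeries S) * X ^ (k - 1) * aSeries a b c φ =
      (mk fun l => tridiagJ ν ω a b c l k) * φ := by
    have hnat : ∀ m : ℕ, (m : PowerSeries S) = C (m : S) := fun m => by simp
    have : (mk fun l => tridiagJ ν ω a b c l k) =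
        X ^ k * (C ν + C ω * X) +
          C (k : S) * X ^ (k - 1) * (C a + C b * X + C c * X ^ 2) := by
      -- For `k = 0` the exponent `k - 1` is truncated to `0`, which is harmless as its terms carry
      -- the factor `k`.
      have hexp : X ^ k * (C ν + C ω * X) +
          C (k : S) * X ^ (k - 1) * (C a + C b * X + C c * X ^ 2) =
          C (k * a) * X ^ (k - 1) + C ν * X ^ k + C ω * X ^ (k + 1) +
            C (k * b) * X ^ (k - 1 + 1) + C (k * c) * X ^ (k - 1 + 2) := by
        simp only [map_mul]
        ring
      rw [hexp]
      ext l
      simp only [coeff_mk, map_add, coeff_C_mul, coeff_X_pow, tridiagJ, Matrix.of_apply]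
      rcases k with _ | k
      · simp only [Nat.cast_zero]
        rcases l with _ | _ | l <;> simp
      · simp only [Nat.add_sub_cancel]
        rcases lt_trichotomy l k with h | h | h
        · simp (disch := omega) [if_neg]
        · subst h
          simp only [Nat.cast_add, Nat.cast_one]
          simp (disch := omega) [if_neg]
        · rcases eq_or_ne l (k + 1) with h1 | h1
          · subst h1
            simp (disch := omega)
          · rcases eq_or_ne l (k + 2) with h2 | h2
            · subst h2
              simp (disch := omega)
            · simp (disch := omega) [if_neg]
    rw [this, zSeries, aSeries, hnat]
    ring
  rw [hcol, coeff_mul, Finset.Nat.sum_antidiagonal_eq_sum_range_succ_mk]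
  simp only [toeplitzTridiag, Matrix.of_apply, coeff_mk]
  exact Finset.sum_congr rfl fun l _ => mul_comm _ _

lemma toeplitzTridiag_hessenberg {S : Type*} [CommRing S] (φ : PowerSeries S) (ν ω a b c : S)
    (i k : ℕ) (h : i + 1 < k) : toeplitzTridiag φ ν ω a b c i k = 0 := by
  rw [toeplitzTridiag, Matrix.of_apply]
  refine Finset.sum_eq_zero fun l hl => ?_
  have := Finset.mem_range.mp hl
  simp only [tridiagJ, Matrix.of_apply]
  simp (disch := omega) [if_neg]

/-- An exponential Riordan array is, up to scaling of the columns, the output matrix of its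
production matrix. -/
theorem algebraMap_outputMat_toeplitzTridiag {S K : Type*} [CommRing S] [Field K] [Algebra S K]
    {g f : PowerSeries K} {φ : PowerSeries S} {ν ω a b c : S}
    (hg : constantCoeff g = 1) (hf : constantCoeff f = 0)
    (hg' : derivative K g =
      g * (subst f ((zSeries ν ω φ).map (algebraMap S K)) : PowerSeries K))
    (hf' : derivative K f = (subst f ((aSeries a b c φ).map (algebraMap S K)) : PowerSeries K))
    (n : ℕ) : ∀ k, algebraMap S K (outputMat (toeplitzTridiag φ ν ω a b c) n k) =
      n.factorial * coeff n (g * f ^ k) := by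
  induction n with
  | zero =>
    intro k
    rcases eq_or_ne k 0 with h | h
    · simp [h, outputMat, hg]
    · simp [outputMat, h, hf]
  | succ n ih =>
    intro k
    have h := coeff_succ_riordan hf hg' hf' n k
    rw [outputMat, map_sum, Nat.factorial_succ, Nat.cast_mul, mul_right_comm]
    rw [Nat.cast_add, Nat.cast_one, mul_comm ((n : K) + 1), h, Finset.sum_mul]
    refine Finset.sum_congr rfl fun i _ => ?_
    rw [map_mul (algebraMap S K), ih, toeplitzTridiag_eq_coeff]
    have hmap : X ^ k * (zSeries ν ω φ).map (algebraMap S K) +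
        (k : PowerSeries K) * X ^ (k - 1) * (aSeries a b c φ).map (algebraMap S K) =
        (X ^ k * zSeries ν ω φ + (k : PowerSeries S) * X ^ (k - 1) * aSeries a b c φ).map
          (algebraMap S K) := by
      simp
    rw [hmap, coeff_map]
    ring

/-- Total positivity of an exponential Riordan array and of the Hankel matrix of its zeroth column,
with coefficients in an `ℝ`-algebra `S` and positivity defined by a subsemiring `P`. -/
theorem IsExpRiordanArray.exists_minorsIn {S K : Type*} [CommRing S] [Algebra ℝ S] [Field K]
    [Algebra S K] {P : Subsemiring S} (hP : ∀ x : ℝ, 0 ≤ x → algebraMap ℝ S x ∈ P) {r : ℕ}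
    {φ : PowerSeries ℝ} {ν ω a b c : S} {R : Matrix ℕ ℕ K} (hφ : IsPFr r φ)
    (hR : IsExpRiordanArray R
      ((zSeries ν ω (φ.map (algebraMap ℝ S))).map (algebraMap S K))
      ((aSeries a b c (φ.map (algebraMap ℝ S))).map (algebraMap S K)))
    (hJ : MinorsIn (P : Set S) r (tridiagJ ν ω a b c)) :
    ∃ M : Matrix ℕ ℕ S, R = M.map (algebraMap S K) ∧
      MinorsIn (P : Set S) r M ∧ MinorsIn (P : Set S) r (hankelMat fun n => M n 0) := by
  obtain ⟨g, f, hg, hf, hg', hf', rfl⟩ := hR.exists_derivative_eq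
  set Q := toeplitzTridiag (φ.map (algebraMap ℝ S)) ν ω a b c with hQdef
  have hess : ∀ i j, i + 1 < j → Q i j = 0 := toeplitzTridiag_hessenberg _ _ _ _ _ _
  have hT : MinorsIn (P : Set S) r ((toeplitzMat φ).map (algebraMap ℝ S)) :=
    MinorsIn.map hφ (algebraMap ℝ S) hP
  have hQ : MinorsIn (P : Set S) r Q := by
    refine hT.mul_of_finite_sums hJ (fun i _ => i + 1) fun i j N hN => ?_
    have hsum : Q i j = ∑ l ∈ Finset.range (i + 1),
        (toeplitzMat φ).map (algebraMap ℝ S) i l * tridiagJ ν ω a b c l j := by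
      rw [hQdef, toeplitzTridiag, Matrix.of_apply]
      refine Finset.sum_congr rfl fun l hl => ?_
      have hl' : l ≤ i := Nat.lt_succ_iff.mp (Finset.mem_range.mp hl)
      simp [toeplitzMat, hl']
    rw [hsum]
    refine Finset.sum_subset (Finset.range_mono hN) fun l _ hl => ?_
    have hl' : ¬ l ≤ i := by have := Finset.mem_range.not.mp hl; omega
    simp [toeplitzMat, hl']
  have hchar : CharZero K := charZero_of_injective_ringHom
    ((algebraMap S K).comp (algebraMap ℝ S)).injective
  -- The division by `k!` takes place in `S`, through its `ℝ`-algebra structure. Column `0` is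
  -- unchanged, so the Hankel matrix is that of the output matrix.
  refine ⟨Matrix.of fun n k => algebraMap ℝ S ((k.factorial : ℝ)⁻¹) * outputMat Q n k, ?_, ?_, ?_⟩
  · ext n k
    have hk : algebraMap S K (algebraMap ℝ S ((k.factorial : ℝ)⁻¹)) = ((k.factorial : K))⁻¹ := by
      rw [← RingHom.comp_apply, map_inv₀, map_natCast]
    rw [Matrix.map_apply, Matrix.of_apply, map_mul, hk,
      algebraMap_outputMat_toeplitzTridiag hg hf hg' hf', expRiordan, Matrix.of_apply]
    ring
  · exact (minorsIn_outputMat hQ hess).scale_columns _ fun k => hP _ (by positivity)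
  · simpa using minorsIn_hankelMat_outputMat hQ hess

end Riordan

/-! ### Coefficientwise nonnegativity -/

/-- The subsemiring of polynomials with nonnegative coefficients. -/
def nonnegCoeffsSubsemiring (σ : Type*) : Subsemiring (MvPolynomial σ ℝ) where
  carrier := {p | NonnegCoeffs p}
  zero_mem' d := by simp
  one_mem' d := by
    classical
    rw [MvPolynomial.coeff_one]
    split_ifs <;> norm_num
  add_mem' hp hq d := by
    rw [MvPolynomial.coeff_add]
    exact add_nonneg (hp d) (hq d)
  mul_mem' hp hq d := by
    classical
    rw [MvPolynomial.coeff_mul]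
    exact Finset.sum_nonneg fun x _ => mul_nonneg (hp _) (hq _)

lemma algebraMap_mem_nonnegCoeffsSubsemiring {σ : Type*} (x : ℝ) (hx : 0 ≤ x) :
    algebraMap ℝ (MvPolynomial σ ℝ) x ∈ nonnegCoeffsSubsemiring σ := by
  classical
  intro d
  rw [MvPolynomial.algebraMap_eq, MvPolynomial.coeff_C]
  split_ifs
  exacts [hx, le_rfl]

/-- Coefficientwise total positivity of exponential Riordan arrays over a polynomial ring. -/
theorem IsExpRiordanArray.exists_isCoeffTPr {σ K : Type*} [Field K]
    [Algebra (MvPolynomial σ ℝ) K] {r : ℕ} {φ : PowerSeries ℝ}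
    {ν ω a b c : MvPolynomial σ ℝ} {R : Matrix ℕ ℕ K} (hφ : IsPFr r φ)
    (hR : IsExpRiordanArray R
      ((zSeries ν ω (φ.map MvPolynomial.C)).map (algebraMap (MvPolynomial σ ℝ) K))
      ((aSeries a b c (φ.map MvPolynomial.C)).map (algebraMap (MvPolynomial σ ℝ) K)))
    (hJ : IsCoeffTPr r (tridiagJ ν ω a b c)) :
    ∃ M : Matrix ℕ ℕ (MvPolynomial σ ℝ), R = M.map (algebraMap (MvPolynomial σ ℝ) K) ∧
      IsCoeffTPr r M ∧ IsCoeffTPr r (hankelMat fun n => M n 0) :=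
  IsExpRiordanArray.exists_minorsIn (P := nonnegCoeffsSubsemiring σ)
    algebraMap_mem_nonnegCoeffsSubsemiring hφ hR hJ

/-- Total positivity of exponential Riordan arrays over `ℝ`. -/
theorem IsExpRiordanArray.isTPr {r : ℕ} {φ : PowerSeries ℝ} {ν ω a b c : ℝ} {R : Matrix ℕ ℕ ℝ}
    (hφ : IsPFr r φ) (hR : IsExpRiordanArray R (zSeries ν ω φ) (aSeries a b c φ))
    (hJ : IsTPr r (tridiagJ ν ω a b c)) :
    IsTPr r R ∧ IsTPr r (hankelMat fun n => R n 0) := by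
  have hmap : ∀ p : PowerSeries ℝ, p.map (algebraMap ℝ ℝ) = p := fun p => by
    rw [Algebra.algebraMap_self, PowerSeries.map_id, id]
  obtain ⟨M, hM, h⟩ := IsExpRiordanArray.exists_minorsIn (P := Subsemiring.nonneg ℝ)
    (fun x hx => by simpa using hx) hφ (S := ℝ) (K := ℝ) (by simpa only [hmap] using hR) hJ
  have : R = M := by
    rw [hM]
    ext i j
    simp
  rw [this]
  exact h

/-! ### Total positivity of the tridiagonal matrix J -/

lemma tridiagJ_eq_tridiag {S : Type*} [CommRing S] (ν ω a b c : S) :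
    tridiagJ ν ω a b c = tridiag (fun n => ν + (n : S) * b) (fun n => ((n : S) + 1) * a)
      (fun n => ω + (n : S) * c) := rfl

theorem isTPr_tridiagJ_of_columnDominant {ν ω a b c : ℝ} (hω : 0 ≤ ω) (ha : 0 ≤ a) (hc : 0 ≤ c)
    (hων : ω ≤ ν) (hb : a + c ≤ b) (r : ℕ) : IsTPr r (tridiagJ ν ω a b c) := by
  rw [tridiagJ_eq_tridiag]
  refine minorsIn_tridiag_of_columnDominant (fun n => by positivity) (fun n => by positivity)
    (by simpa using hων) (fun n => ?_) r
  have hn : (0 : ℝ) ≤ n := n.cast_nonneg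
  push_cast
  nlinarith

theorem isTPr_tridiagJ_of_rowDominant {ν ω a b c : ℝ} (hω : 0 ≤ ω) (ha : 0 ≤ a) (hc : 0 ≤ c)
    (haν : a ≤ ν) (hb : max (a + c) (a + ω) ≤ b) (r : ℕ) : IsTPr r (tridiagJ ν ω a b c) := by
  have h1 : a + c ≤ b := (le_max_left _ _).trans hb
  have h2 : a + ω ≤ b := (le_max_right _ _).trans hb
  have h : IsTPr r (tridiagJ ν ω a b c).transpose := by
    rw [tridiagJ_eq_tridiag, tridiag_transpose]
    refine minorsIn_tridiag_of_columnDominant (fun n => by positivity) (fun n => by positivity)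
      (by simpa using haν) (fun n => ?_) r
    have hn : (0 : ℝ) ≤ n := n.cast_nonneg
    push_cast
    nlinarith
  exact MinorsIn.transpose h

theorem isCoeffTPr_tridiagJ_of_upper {σ : Type*} {ν a b : MvPolynomial σ ℝ} (hν : NonnegCoeffs ν)
    (ha : NonnegCoeffs a) (hb : NonnegCoeffs b) (r : ℕ) :
    IsCoeffTPr r (tridiagJ ν 0 a b 0) := by
  have heq : tridiagJ ν 0 a b 0 = upperBidiag (fun n => ν + (n : MvPolynomial σ ℝ) * b)
      (fun n => ((n : MvPolynomial σ ℝ) + 1) * a) := by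
    ext1 i j
    simp [tridiagJ, upperBidiag]
  rw [heq]
  exact minorsIn_upperBidiag (P := nonnegCoeffsSubsemiring σ)
    (fun n => add_mem hν (mul_mem (natCast_mem _ n) hb))
    (fun n => mul_mem (add_mem (natCast_mem _ n) (one_mem _)) ha) r

/-! ### Branched continued fractions of Stieltjes type -/

section Branched

open PowerSeries

lemma PowerSeries.X_pow_dvd_prod_sub_prod {F ι : Type*} [Field F] {n : ℕ} (s : Finset ι)
    {p q : ι → PowerSeries F} (h : ∀ i ∈ s, X ^ n ∣ p i - q i) :
    X ^ n ∣ ∏ i ∈ s, p i - ∏ i ∈ s, q i := by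
  rw [← Ideal.mem_span_singleton, ← Ideal.Quotient.mk_eq_mk_iff_sub_mem, map_prod, map_prod]
  refine Finset.prod_congr rfl fun i hi => ?_
  rw [Ideal.Quotient.mk_eq_mk_iff_sub_mem, Ideal.mem_span_singleton]
  exact h i hi

variable {F : Type*} [Field F] (m : ℕ) (α : ℕ → F)

lemma branchedSTrunc_mul_eq_one (d k : ℕ) :
    branchedSTrunc m α (d + 1) k * (1 - C (α (m + k)) * X *
      ∏ i : Fin m, branchedSTrunc m α d (k + ((i : ℕ) + 1))) = 1 := by
  rw [branchedSTrunc]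
  exact PowerSeries.inv_mul_cancel _ (by simp)

/-- The tails enter with a factor `t`, so each level gains one order of agreement. -/
lemma X_pow_dvd_branchedSTrunc_succ_sub (d : ℕ) :
    ∀ k, X ^ d ∣ branchedSTrunc m α (d + 1) k - branchedSTrunc m α d k := by
  induction d with
  | zero => intro k; simp
  | succ d ih =>
    intro k
    have h1 := branchedSTrunc_mul_eq_one m α (d + 1) k
    have h2 := branchedSTrunc_mul_eq_one m α d k
    obtain ⟨w, hw⟩ := X_pow_dvd_prod_sub_prod (Finset.univ : Finset (Fin m))
      (fun i _ => ih (k + ((i : ℕ) + 1)))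
    set p := ∏ i : Fin m, branchedSTrunc m α (d + 1) (k + ((i : ℕ) + 1))
    set q := ∏ i : Fin m, branchedSTrunc m α d (k + ((i : ℕ) + 1))
    set U := branchedSTrunc m α (d + 1 + 1) k
    set V := branchedSTrunc m α (d + 1) k
    refine ⟨U * V * C (α (m + k)) * w, ?_⟩
    -- `U - V = U V (1/V - 1/U)`, and the reciprocals differ by `α t (p - q)`.
    linear_combination (-U) * h2 + V * h1 + U * V * C (α (m + k)) * X * hw

/-- The continued fraction started at position `k`, as the limit of its truncations. -/
noncomputable def branchedSLimit (k : ℕ) : PowerSeries F :=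
  mk fun n => coeff n (branchedSTrunc m α (n + 1) k)

lemma coeff_branchedSTrunc {n d : ℕ} (h : n < d) (k : ℕ) :
    coeff n (branchedSTrunc m α d k) = coeff n (branchedSLimit m α k) := by
  rw [branchedSLimit, coeff_mk]
  induction d, h using Nat.le_induction with
  | base => rfl
  | succ d hd ih =>
    rw [← ih, ← sub_eq_zero, ← map_sub]
    exact X_pow_dvd_iff.mp (X_pow_dvd_branchedSTrunc_succ_sub m α d k) n hd

lemma X_pow_dvd_branchedSLimit_sub (d k : ℕ) :
    X ^ d ∣ branchedSLimit m α k - branchedSTrunc m α d k := by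
  rw [X_pow_dvd_iff]
  intro n hn
  rw [map_sub, coeff_branchedSTrunc m α hn, sub_self]

/-- The defining relation with its denominator cleared, checked modulo every `X ^ d` against the
truncations. -/
lemma branchedSLimit_eq (k : ℕ) :
    branchedSLimit m α k = 1 + C (α (m + k)) * X *
      (branchedSLimit m α k * ∏ i : Fin m, branchedSLimit m α (k + 1 + (i : ℕ))) := by
  have key : ∀ d, X ^ d ∣ branchedSLimit m α k - (1 + C (α (m + k)) * X *
      (branchedSLimit m α k * ∏ i : Fin m, branchedSLimit m α (k + ((i : ℕ) + 1)))) := by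
    intro d
    have h1 := branchedSTrunc_mul_eq_one m α d k
    obtain ⟨w, hw⟩ := X_pow_dvd_prod_sub_prod (Finset.univ : Finset (Fin m))
      (fun i _ => X_pow_dvd_branchedSLimit_sub m α d (k + ((i : ℕ) + 1)))
    obtain ⟨v, hv⟩ := (pow_dvd_pow X (Nat.le_succ d)).trans
      (X_pow_dvd_branchedSLimit_sub m α (d + 1) k)
    set p := ∏ i : Fin m, branchedSLimit m α (k + ((i : ℕ) + 1))
    set q := ∏ i : Fin m, branchedSTrunc m α d (k + ((i : ℕ) + 1))
    set f := branchedSLimit m α k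
    set V := branchedSTrunc m α (d + 1) k
    refine ⟨v * (1 - C (α (m + k)) * X * p) - V * C (α (m + k)) * X * w, ?_⟩
    linear_combination (1 - C (α (m + k)) * X * p) * hv - V * C (α (m + k)) * X * hw + h1
  have hidx : ∏ i : Fin m, branchedSLimit m α (k + 1 + (i : ℕ)) =
      ∏ i : Fin m, branchedSLimit m α (k + ((i : ℕ) + 1)) :=
    Finset.prod_congr rfl fun i _ => by rw [add_assoc, add_comm 1]
  rw [hidx, ← sub_eq_zero]
  ext n
  exact X_pow_dvd_iff.mp (key (n + 1)) n (Nat.lt_succ_self n)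

/-- The products of consecutive tails of the continued fraction. -/
noncomputable def branchedSProd (k : ℕ) : PowerSeries F :=
  ∏ i ∈ Finset.range k, branchedSLimit m α i

/-- Multiply the equation for the tail at `k` by the product of the earlier tails. -/
lemma branchedSProd_succ (k : ℕ) :
    branchedSProd m α (k + 1) =
      branchedSProd m α k + C (α (m + k)) * X * branchedSProd m α (k + m + 1) := by
  have h : branchedSProd m α (k + m + 1) = branchedSProd m α k *
      (branchedSLimit m α k * ∏ i : Fin m, branchedSLimit m α (k + 1 + (i : ℕ))) := by
    rw [branchedSProd, show k + m + 1 = k + 1 + m by ring, Finset.prod_range_add,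
      Finset.prod_range_succ, ← Finset.prod_range fun i => branchedSLimit m α (k + 1 + i),
      branchedSProd, mul_assoc]
  rw [h, branchedSProd, Finset.prod_range_succ, ← branchedSProd]
  conv_lhs => rw [branchedSLimit_eq]
  ring

/-- The linear map sending `X ^ k` to the generating function of the `k`-th column of the output
matrix, multiplied by `k!`. -/
noncomputable def branchedSMap : Polynomial F →ₗ[F] PowerSeries F :=
  (Polynomial.basisMonomials F).constr F fun k =>
    C (k.factorial : F) * X ^ k * branchedSProd m α (k * (m + 1) + 1)

lemma Polynomial.basisMonomials_apply (k : ℕ) :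
    Polynomial.basisMonomials F k = Polynomial.X ^ k := by
  rw [Polynomial.coe_basisMonomials]
  exact Polynomial.monomial_one_right_eq_X_pow k

lemma branchedSMap_X_pow (k : ℕ) :
    branchedSMap m α (Polynomial.X ^ k) =
      C (k.factorial : F) * X ^ k * branchedSProd m α (k * (m + 1) + 1) := by
  have := (Polynomial.basisMonomials F).constr_basis F
    (fun k => C (k.factorial : F) * X ^ k * branchedSProd m α (k * (m + 1) + 1)) k
  rwa [Polynomial.basisMonomials_apply] at this

variable {m α}

/-- Each factor `1 + x_i X` is one step of `branchedSProd_succ`: the coefficient `(k + 1) x_i` turns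
`k!` into `(k + 1)!`, and the index shift by `m + 1` turns `X ^ k` into `X ^ (k + 1)`. -/
lemma branchedSMap_X_pow_mul_prod {x : ℕ → F}
    (hα : ∀ q, ∀ i < m, α (m + q * (m + 1) + (i + 1)) = ((q : F) + 1) * x i) :
    ∀ i ≤ m, ∀ k, branchedSMap m α (Polynomial.X ^ k *
      ∏ j ∈ Finset.range i, (1 + Polynomial.C (x j) * Polynomial.X)) =
      C (k.factorial : F) * X ^ k * branchedSProd m α (k * (m + 1) + i + 1) := by
  intro i
  induction i with
  | zero => intro _ k; simpa using branchedSMap_X_pow m α k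
  | succ i ih =>
    intro hi k
    have hpoly : (Polynomial.X ^ k *
        ∏ j ∈ Finset.range (i + 1), (1 + Polynomial.C (x j) * Polynomial.X) : Polynomial F) =
        Polynomial.X ^ k * ∏ j ∈ Finset.range i, (1 + Polynomial.C (x j) * Polynomial.X) +
        x i • (Polynomial.X ^ (k + 1) *
          ∏ j ∈ Finset.range i, (1 + Polynomial.C (x j) * Polynomial.X)) := by
      rw [Finset.prod_range_succ, Polynomial.smul_eq_C_mul]
      ring
    rw [hpoly, map_add, map_smul, ih (by omega), ih (by omega),
      branchedSProd_succ m α (k * (m + 1) + (i + 1)),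
      show m + (k * (m + 1) + (i + 1)) = m + k * (m + 1) + (i + 1) by ring, hα k i (by omega),
      show k * (m + 1) + (i + 1) + m + 1 = (k + 1) * (m + 1) + i + 1 by ring,
      smul_eq_C_mul, Nat.factorial_succ]
    push_cast
    simp only [map_mul, map_add, map_one, ← add_assoc]
    ring

/-- The functional equation satisfied by the generating functions of the columns. -/
lemma branchedSMap_X_pow_eq {x : ℕ → F} {ν b : F} (hα' : ∀ q : ℕ, α (m + q * (m + 1)) = ν + q * b)
    (hα : ∀ q, ∀ i < m, α (m + q * (m + 1) + (i + 1)) = ((q : F) + 1) * x i) (k : ℕ) :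
    branchedSMap m α (Polynomial.X ^ k) = (if k = 0 then 1 else 0) + X * branchedSMap m α
      ((∏ j ∈ Finset.range m, (1 + Polynomial.C (x j) * Polynomial.X)) *
        (Polynomial.C ν * Polynomial.X ^ k +
          (1 + Polynomial.C b * Polynomial.X) * Polynomial.derivative (Polynomial.X ^ k))) := by
  have hprod := branchedSMap_X_pow_mul_prod hα m le_rfl
  set Φ : Polynomial F := ∏ j ∈ Finset.range m, (1 + Polynomial.C (x j) * Polynomial.X)
  rw [branchedSMap_X_pow, branchedSProd_succ, hα']
  -- For `k = 0` the remaining product is empty and gives the constant `1`; otherwise it is the full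
  -- image of `X ^ (k - 1) * Φ`, which gives the derivative term.
  rcases k with _ | k
  · have hpoly : Φ * (Polynomial.C ν * Polynomial.X ^ 0 +
        (1 + Polynomial.C b * Polynomial.X) * Polynomial.derivative (Polynomial.X ^ 0)) =
        ν • (Polynomial.X ^ 0 * Φ) := by
      rw [Polynomial.smul_eq_C_mul]
      simp only [pow_zero, Polynomial.derivative_one]
      ring
    rw [hpoly, map_smul, hprod, smul_eq_C_mul]
    simp [branchedSProd]
    ring
  · have hpoly : Φ * (Polynomial.C ν * Polynomial.X ^ (k + 1) +
        (1 + Polynomial.C b * Polynomial.X) * Polynomial.derivative (Polynomial.X ^ (k + 1))) =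
        (ν + (k + 1 : ℕ) * b) • (Polynomial.X ^ (k + 1) * Φ) +
          ((k + 1 : ℕ) : F) • (Polynomial.X ^ k * Φ) := by
      rw [Polynomial.smul_eq_C_mul, Polynomial.smul_eq_C_mul, Polynomial.derivative_X_pow]
      simp only [map_add, map_mul, Nat.add_sub_cancel]
      ring
    rw [hpoly, map_add (branchedSMap m α), map_smul, map_smul, hprod, hprod, smul_eq_C_mul, smul_eq_C_mul,
      Nat.factorial_succ, show (k + 1) * (m + 1) = k * (m + 1) + m + 1 by ring]
    simp only [Nat.cast_mul, map_mul, Nat.add_eq_zero_iff, one_ne_zero, and_false, if_false]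
    ring

/-- The factorial-weighted coefficient functionals of an exponential Riordan array. -/
noncomputable def riordanFunctional (g f : PowerSeries F) (n : ℕ) : Polynomial F →ₗ[F] F :=
  (n.factorial : F) • (coeff n ∘ₗ LinearMap.mulLeft F g ∘ₗ (Polynomial.aeval f).toLinearMap)

lemma riordanFunctional_apply (g f : PowerSeries F) (n : ℕ) (p : Polynomial F) :
    riordanFunctional g f n p = n.factorial * coeff n (g * Polynomial.aeval f p) := rfl

/-- The derivative of `g p(f)` is again `g` times a polynomial in `f`, by the two differential
equations. -/
lemma riordanFunctional_succ {g f : PowerSeries F} {Φ : Polynomial F} {ν b : F}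
    (hf : constantCoeff f = 0)
    (hg' : derivative F g = g * (subst f (zSeries ν 0 (Φ : PowerSeries F)) : PowerSeries F))
    (hf' : derivative F f = (subst f (aSeries 1 b 0 (Φ : PowerSeries F)) : PowerSeries F))
    (n : ℕ) (p : Polynomial F) :
    riordanFunctional g f (n + 1) p = riordanFunctional g f n
      (Φ * (Polynomial.C ν * p + (1 + Polynomial.C b * Polynomial.X) * Polynomial.derivative p)) := by
  have hsf : HasSubst f := HasSubst.of_constantCoeff_zero' hf
  have hz : zSeries ν 0 (Φ : PowerSeries F) = ((Polynomial.C ν * Φ : Polynomial F) : PowerSeries F) := by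
    simp [zSeries]
  have ha : aSeries 1 b 0 (Φ : PowerSeries F) =
      (((1 + Polynomial.C b * Polynomial.X) * Φ : Polynomial F) : PowerSeries F) := by
    simp [aSeries]
  have hp : derivative F (Polynomial.aeval f p : PowerSeries F) =
      Polynomial.aeval f (Polynomial.derivative p) * derivative F f := by
    rw [← subst_coe hsf, derivative_subst hsf, derivative_coe, subst_coe hsf]
  have hder : derivative F (g * Polynomial.aeval f p) = g * Polynomial.aeval f
      (Φ * (Polynomial.C ν * p +
        (1 + Polynomial.C b * Polynomial.X) * Polynomial.derivative p)) := by
    rw [Derivation.leibniz, hp, hg', hf', hz, ha, subst_coe hsf, subst_coe hsf]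
    simp only [smul_eq_mul, map_mul, map_add]
    ring
  rw [riordanFunctional_apply, riordanFunctional_apply, ← hder, coeff_derivative,
    Nat.factorial_succ]
  push_cast
  ring

/-- The zeroth column of an exponential Riordan array with `A = (1 + b t) φ` and `Z = ν φ`, where
`φ` is a product of linear factors, is generated by a branched continued fraction. -/
theorem IsExpRiordanArray.isBranchedSFraction {x : Fin m → F} {ν b : F} {R : Matrix ℕ ℕ F}
    (hR : IsExpRiordanArray R
      (zSeries ν 0 (∏ i : Fin m, (1 + C (x i) * X)))
      (aSeries 1 b 0 (∏ i : Fin m, (1 + C (x i) * X))))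
    (hα' : ∀ q : ℕ, α (m + q * (m + 1)) = ν + (q : F) * b)
    (hα : ∀ (q : ℕ) (i : Fin m), α (m + q * (m + 1) + ((i : ℕ) + 1)) = ((q : F) + 1) * x i) :
    IsBranchedSFraction m α (mk fun n => R n 0) := by
  obtain ⟨g, f, hg, hf, hg', hf', rfl⟩ := hR.exists_derivative_eq
  let y : ℕ → F := fun j => if h : j < m then x ⟨j, h⟩ else 0
  have hy : ∀ i : Fin m, y i = x i := fun i => by simp [y]
  have hα'' : ∀ q, ∀ i < m, α (m + q * (m + 1) + (i + 1)) = ((q : F) + 1) * y i := by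
    intro q i hi
    rw [hα q ⟨i, hi⟩, ← hy]
  have hΦ : ∏ i : Fin m, (1 + C (x i) * X) = ((∏ j ∈ Finset.range m,
      (1 + Polynomial.C (y j) * Polynomial.X) : Polynomial F) : PowerSeries F) := by
    rw [Finset.prod_range, ← Polynomial.coeToPowerSeries.ringHom_apply, map_prod]
    exact Finset.prod_congr rfl fun i _ => by simp [hy]
  rw [hΦ] at hg' hf'
  -- Both families take the value `1` at `X ^ 0` and `0` at higher powers for `n = 0`, and obey the
  -- same recursion in `n`.
  have key : ∀ n, coeff n ∘ₗ branchedSMap m α = riordanFunctional g f n := by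
    intro n
    induction n with
    | zero =>
      refine (Polynomial.basisMonomials F).ext fun k => ?_
      rw [Polynomial.basisMonomials_apply,
        LinearMap.comp_apply, branchedSMap_X_pow_eq hα' hα'', riordanFunctional_apply]
      rcases eq_or_ne k 0 with h | h
      · simp [h, hg]
      · simp [h, hf]
    | succ n ih =>
      refine (Polynomial.basisMonomials F).ext fun k => ?_
      rw [Polynomial.basisMonomials_apply,
        LinearMap.comp_apply, branchedSMap_X_pow_eq hα' hα'', riordanFunctional_succ hf hg' hf',
        ← ih, map_add, coeff_succ_X_mul, LinearMap.comp_apply]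
      split_ifs <;> simp [coeff_one]
  intro n
  filter_upwards [eventually_gt_atTop n] with d hd
  have h1 := LinearMap.congr_fun (key n) (Polynomial.X ^ 0)
  rw [LinearMap.comp_apply, branchedSMap_X_pow, riordanFunctional_apply] at h1
  rw [coeff_branchedSTrunc m α hd, coeff_mk, expRiordan, Matrix.of_apply]
  simpa [branchedSProd] using h1

end Branched
-- The five statements
theorem mainTheorem4
    {σ : Type*} {K : Type*} [Field K] [Algebra (MvPolynomial σ ℝ) K]
    [IsFractionRing (MvPolynomial σ ℝ) K]
    {F : Type*} [Field F] [CharZero F] :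
    -- (i)
    (∀ (r : ℕ) (φ : PowerSeries ℝ) (ν ω a b c : MvPolynomial σ ℝ) (R : Matrix ℕ ℕ K),
      IsPFr r φ →
      IsExpRiordanArray R
        ((zSeries ν ω (φ.map MvPolynomial.C)).map (algebraMap (MvPolynomial σ ℝ) K))
        ((aSeries a b c (φ.map MvPolynomial.C)).map (algebraMap (MvPolynomial σ ℝ) K)) →
      IsCoeffTPr r (tridiagJ ν ω a b c) →
      ∃ M : Matrix ℕ ℕ (MvPolynomial σ ℝ),
        R = M.map (algebraMap (MvPolynomial σ ℝ) K) ∧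
        IsCoeffTPr r M ∧ IsCoeffTPr r (hankelMat fun n => M n 0)) ∧
    -- (ii)
    (∀ (φ : PowerSeries ℝ) (ν ω a b c : ℝ) (R : Matrix ℕ ℕ ℝ),
      IsExpRiordanArray R (zSeries ν ω φ) (aSeries a b c φ) →
      0 ≤ ν → 0 ≤ ω → 0 ≤ a → 0 ≤ b → 0 ≤ c → ω ≤ ν → a + c ≤ b →
      (∀ r, IsPFr r φ → IsTPr r R ∧ IsTPr r (hankelMat fun n => R n 0)) ∧
      (IsPF φ → IsTP R ∧ IsTP (hankelMat fun n => R n 0))) ∧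
    -- (iii)
    (∀ (φ : PowerSeries ℝ) (ν ω a b c : ℝ) (R : Matrix ℕ ℕ ℝ),
      IsExpRiordanArray R (zSeries ν ω φ) (aSeries a b c φ) →
      0 ≤ ν → 0 ≤ ω → 0 ≤ a → 0 ≤ b → 0 ≤ c → a ≤ ν → max (a + c) (a + ω) ≤ b →
      (∀ r, IsPFr r φ → IsTPr r R ∧ IsTPr r (hankelMat fun n => R n 0)) ∧
      (IsPF φ → IsTP R ∧ IsTP (hankelMat fun n => R n 0))) ∧
    -- (iv), with `a`, `b`, `ν` the indeterminates or, more generally, any polynomials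
    -- with nonnegative coefficients
    (∀ (φ : PowerSeries ℝ) (ν a b : MvPolynomial σ ℝ) (R : Matrix ℕ ℕ K),
      IsPF φ →
      NonnegCoeffs ν → NonnegCoeffs a → NonnegCoeffs b →
      IsExpRiordanArray R
        ((zSeries ν 0 (φ.map MvPolynomial.C)).map (algebraMap (MvPolynomial σ ℝ) K))
        ((aSeries a b 0 (φ.map MvPolynomial.C)).map (algebraMap (MvPolynomial σ ℝ) K)) →
      ∃ M : Matrix ℕ ℕ (MvPolynomial σ ℝ),
        R = M.map (algebraMap (MvPolynomial σ ℝ) K) ∧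
        IsCoeffTP M ∧ IsCoeffTP (hankelMat fun n => M n 0)) ∧
    -- (v)
    (∀ (m : ℕ) (x : Fin m → F) (ν b : F) (R : Matrix ℕ ℕ F) (α : ℕ → F),
      IsExpRiordanArray R
        (zSeries ν 0 (∏ i : Fin m, (1 + PowerSeries.C (x i) * PowerSeries.X)))
        (aSeries 1 b 0 (∏ i : Fin m, (1 + PowerSeries.C (x i) * PowerSeries.X))) →
      (∀ q : ℕ, α (m + q * (m + 1)) = ν + (q : F) * b) →
      (∀ (q : ℕ) (i : Fin m),
        α (m + q * (m + 1) + ((i : ℕ) + 1)) = ((q : F) + 1) * x i) →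
      IsBranchedSFraction m α (PowerSeries.mk fun n => R n 0)) := by
  refine ⟨fun r φ ν ω a b c R hφ hR hJ => hR.exists_isCoeffTPr hφ hJ, ?_, ?_, ?_, ?_⟩
  · intro φ ν ω a b c R hR _ hω ha _ hc hων hb
    have h : ∀ r, IsPFr r φ → IsTPr r R ∧ IsTPr r (hankelMat fun n => R n 0) := fun r hφ =>
      hR.isTPr hφ (isTPr_tridiagJ_of_columnDominant hω ha hc hων hb r)
    exact ⟨h, fun hφ => ⟨fun r => (h r (hφ r)).1, fun r => (h r (hφ r)).2⟩⟩
  · intro φ ν ω a b c R hR _ hω ha _ hc haν hb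
    have h : ∀ r, IsPFr r φ → IsTPr r R ∧ IsTPr r (hankelMat fun n => R n 0) := fun r hφ =>
      hR.isTPr hφ (isTPr_tridiagJ_of_rowDominant hω ha hc haν hb r)
    exact ⟨h, fun hφ => ⟨fun r => (h r (hφ r)).1, fun r => (h r (hφ r)).2⟩⟩
  · intro φ ν a b R hφ hν ha hb hR
    have h := fun r => hR.exists_isCoeffTPr (hφ r) (isCoeffTPr_tridiagJ_of_upper hν ha hb r)
    obtain ⟨M, hM, -⟩ := h 0
    -- The matrix over the polynomial ring could depend on `r`; injectivity of the map to the
    -- fraction field shows that it does not.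
    have hr : ∀ r, IsCoeffTPr r M ∧ IsCoeffTPr r (hankelMat fun n => M n 0) := by
      intro r
      obtain ⟨M', hM', hTP⟩ := h r
      have : M = M' := by
        ext1 i j
        refine IsFractionRing.injective (MvPolynomial σ ℝ) K ?_
        exact congrFun (congrFun (hM.symm.trans hM') i) j
      rwa [this]
    exact ⟨M, hM, fun r => (hr r).1, fun r => (hr r).2⟩
  · exact fun m x ν b R α hR hα' hα => hR.isBranchedSFraction hα' hα
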